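/- **Setting.** Let $N\ge d\ge 1$, $f:\mathbb{R}^N\to\mathbb{R}^N$, $B\in\mathbb{R}^{N\times d}$, $k:\mathbb{R}^N\to\mathbb{R}^d$. Let $(\xi_n)_{n\ge0}$ be IID real random variables with $E[\xi_n]=\mu$, $E[(\xi_n-\mu)^2]=\sigma^2\ne0$, and let $(\gamma_n)_{n\ge 0}$ be IID $\mathbb{R}^N$-valued random variables with $E[\gamma_n]=0$, $E\|\gamma_n\|^2<\infty$. For a deterministic input sequence $w=(w_n)$ in $\mathbb{R}^d$ consider $$x_{n+1}=f(x_n)+\xi_nBk(x_n)+\xi_nBw_n+\gamma_n \qquad\text{(with noise)},\qquad x_{n+1}=f(x_n)+\xi_nBk(x_n)+\xi_nBw_n\qquad\text{(without noise)}.$$ "Almost all" refers to Lebesgue measure, $'$ is the transpose, and matrix inequalities are in the sense of symmetric matrices. **Mean-square exponential incremental stability.** For every $w$, and both with and without the noise $\gamma$, there are constants $0<K<\infty$ and $0<\beta<1$, not depending on the initial states, such that for almost all $x_0,y_0\in\mathbb{R}^N$, and also for $x_0=0$ and almost all $y_0$, the two trajectories started at $x_0$ and $y_0$ and driven by the same $w,\xi,\gamma$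 satisfy $E\|x_{n+1}-y_{n+1}\|^2\le K\beta^n\|x_0-y_0\|^2$ for all $n\ge0$. **Assumptions on the plant.** 1. $f$ is $C^1$, $f(0)=0$; for almost all $x$ and for $x=0$ the Jacobian $\frac{\partial f}{\partial x}(x)$ is invertible and bounded by a constant independent of $x$; all (complex) eigenvalues $\lambda_0^1,\dots,\lambda_0^N$ of $\frac{\partial f}{\partial x}(0)$, listed with multiplicity, satisfy $|\lambda_0^i|>1$; and $B'B>0$. 2. There are $k_1,k_2>0$ and an integer $r\ge0$ such that $k_1I\le\sum_{\ell=0}^{r}\Phi(x_r,x_\ell)BB'\Phi(x_r,x_\ell)'\le k_2I$ for almost all $x_0$ and for $x_0=0$, where $x_{n+1}=f(x_n)$ and $\Phi(x_r,x_\ell)=\frac{\partial f}{\partial x}(x_r)\cdots\frac{\partial f}{\partial x}(x_\ell)$. 3. The system $x_{n+1}=f(x_n)$ has a unique physical invariant measure $m$, all of whose Lyapunov exponents are positive. That is: $m$ is an ergodic $f$-invariant Borel probability measure on $\mathbb{R}^N$; for almost all $x_0$ and all bounded continuous $\varphi:\mathbb{R}^N\to\mathbb{R}$ one has $\lim_{n\to\infty}\frac1n\sum_{j=0}^n\varphi(x_j)=\int\varphi\,dm$;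 and there are $\Lambda^1_{\exp},\dots,\Lambda^N_{\exp}>0$ such that for $m$-almost every $x_0$ the limit $L(x_0)=\lim_{n\to\infty}\big[\Phi(x_n,x_0)'\Phi(x_n,x_0)\big]^{1/(2n)}$ exists and has eigenvalues, with multiplicity, $\lambda^i_{\exp}=e^{\Lambda^i_{\exp}}$, $i=1,\dots,N$. **Assumption on the controller.** $k$ is $C^1$ with uniformly bounded Jacobian, $k(0)=0$, and there is $\alpha>0$ with $\big(\frac{\partial f}{\partial x}+\mu B\frac{\partial k}{\partial x}\big)'\big(\frac{\partial f}{\partial x}+\mu B\frac{\partial k}{\partial x}\big)\ge\alpha I$ for almost all $x\in\mathbb{R}^N$. **Theorem.** Under these assumptions, put $\rho=\frac{\mu^2}{\mu^2+\sigma^2}$ and $\bar\rho=1-\rho=\frac{\sigma^2}{\mu^2+\sigma^2}$. If the closed loop is mean-square exponentially incrementally stable, then: * if $1\le d<N$, then $\displaystyle \bar\rho^{\,d}\,\max\Big(\prod_{i=1}^N(\lambda^i_{\exp})^2,\ \prod_{i=1}^N|\lambda^i_0|^2\Big)<1$; * if $d=N$, then $\displaystyle \bar\rho\,\max\big((\max_i\lambda^i_{\exp})^2,\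 \max_i|\lambda_0^i|^2\big)<1$. -/

import Mathlib

open MeasureTheory ProbabilityTheory Filter Topology

noncomputable section

namespace FadingChannel

/-- The state space `ℝ^N` (and the input space `ℝ^d`) with its Euclidean norm. -/
abbrev Vec (N : ℕ) : Type := EuclideanSpace ℝ (Fin N)

/-- The property `Q` holds for Lebesgue almost all `x ∈ ℝ^N` and also for `x = 0`. -/
def AEAndZero {N : ℕ} (Q : Vec N → Prop) : Prop :=
  (∀ᵐ x ∂(volume : Measure (Vec N)), Q x) ∧ Q 0

/-- The matrix `B` acting on a Euclidean vector. -/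
def act {N d : ℕ} (B : Matrix (Fin N) (Fin d) ℝ) (u : Vec d) : Vec N :=
  WithLp.toLp 2 (B.mulVec u.ofLp)

/-- The Jacobian matrix `∂g/∂x (x)`, in the standard coordinates. -/
def jac {N M : ℕ} (g : Vec N → Vec M) (x : Vec N) : Matrix (Fin M) (Fin N) ℝ :=
  Matrix.of fun i j => fderiv ℝ g x (EuclideanSpace.single j 1) i

/-- `jacProd f x n` is the product `∂f/∂x (x_n) ⋯ ∂f/∂x (x_0)` of `n + 1` Jacobians along the
orbit `x_{j+1} = f (x_j)` that starts at `x_0 = x`. -/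
def jacProd {N : ℕ} (f : Vec N → Vec N) (x : Vec N) : ℕ → Matrix (Fin N) (Fin N) ℝ
  | 0 => jac f x
  | n + 1 => jac f (f^[n + 1] x) * jacProd f x n

/-- `transition f x k l = Φ(x_k, x_l) = ∂f/∂x (x_k) ⋯ ∂f/∂x (x_l)` for `l ≤ k`, along the orbit
of `x_0 = x`. -/
def transition {N : ℕ} (f : Vec N → Vec N) (x : Vec N) (k l : ℕ) : Matrix (Fin N) (Fin N) ℝ :=
  jacProd f (f^[l] x) (k - l)

/-- The complex eigenvalues of a real square matrix, with algebraic multiplicity. -/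
def eigenvaluesC {N : ℕ} (A : Matrix (Fin N) (Fin N) ℝ) : Multiset ℂ :=
  (A.map (algebraMap ℝ ℂ)).charpoly.roots

/-- Standing assumption on the open loop map `f` and the control matrix `B`. -/
structure PlantAssumption {N d : ℕ} (f : Vec N → Vec N) (B : Matrix (Fin N) (Fin d) ℝ) :
    Prop where
  contDiff : ContDiff ℝ 1 f
  jac_invertible : AEAndZero fun x => IsUnit (jac f x).det
  jac_bounded : ∃ M : ℝ, AEAndZero fun x => ‖fderiv ℝ f x‖ ≤ M
  map_zero : f 0 = 0
  eigenvalues_zero : ∀ z ∈ eigenvaluesC (jac f 0), 1 < ‖z‖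
  control : (B.transpose * B).PosDef

/-- Uniform complete controllability of the linearization along orbits:
`k₁ I ≤ ∑_{l=0}^{k} Φ(x_k, x_l) B B' Φ'(x_k, x_l) ≤ k₂ I`. -/
def UniformlyControllable {N d : ℕ} (f : Vec N → Vec N) (B : Matrix (Fin N) (Fin d) ℝ) : Prop :=
  ∃ k₁ k₂ : ℝ, 0 < k₁ ∧ 0 < k₂ ∧ ∃ k : ℕ, AEAndZero fun x =>
    let G : Matrix (Fin N) (Fin N) ℝ := ∑ l ∈ Finset.range (k + 1),
      transition f x k l * B * B.transpose * (transition f x k l).transpose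
    (G - k₁ • (1 : Matrix (Fin N) (Fin N) ℝ)).PosSemidef ∧
      (k₂ • (1 : Matrix (Fin N) (Fin N) ℝ) - G).PosSemidef

/-- The assumption on the state feedback `k`; `μ` is the mean of the channel gain. -/
structure ControllerAssumption {N d : ℕ} (f : Vec N → Vec N) (B : Matrix (Fin N) (Fin d) ℝ)
    (μ : ℝ) (k : Vec N → Vec d) : Prop where
  contDiff : ContDiff ℝ 1 k
  jac_bounded : ∃ M : ℝ, ∀ x, ‖fderiv ℝ k x‖ ≤ M
  map_zero : k 0 = 0
  nondegenerate : ∃ α : ℝ, 0 < α ∧ ∀ᵐ x ∂(volume : Measure (Vec N)),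
    ((jac f x + μ • (B * jac k x)).transpose * (jac f x + μ • (B * jac k x)) -
      α • (1 : Matrix (Fin N) (Fin N) ℝ)).PosSemidef

/-- An independent and identically distributed sequence of random variables. -/
structure IsIID {Ω E : Type*} [MeasurableSpace Ω] [MeasurableSpace E] (P : Measure Ω)
    (X : ℕ → Ω → E) : Prop where
  measurable : ∀ n, Measurable (X n)
  indep : iIndepFun X P
  identDistrib : ∀ n, IdentDistrib (X n) (X 0) P P

/-- The multiplicative channel noise: IID, with mean `μ` and variance `σ² ≠ 0`. -/
structure ChannelNoise {Ω : Type*} [MeasurableSpace Ω] (P : Measure Ω) (μ σ : ℝ)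
    (ξ : ℕ → Ω → ℝ) : Prop where
  iid : IsIID P ξ
  memLp : MemLp (ξ 0) 2 P
  mean : ∫ ω, ξ 0 ω ∂P = μ
  variance : ∫ ω, (ξ 0 ω - μ) ^ 2 ∂P = σ ^ 2
  sigma_ne_zero : σ ≠ 0

/-- The additive noise: IID, with mean zero and finite second moment. -/
structure AdditiveNoise {N : ℕ} {Ω : Type*} [MeasurableSpace Ω] (P : Measure Ω)
    (γ : ℕ → Ω → Vec N) : Prop where
  iid : IsIID P γ
  memLp : MemLp (γ 0) 2 P
  mean : ∫ ω, γ 0 ω ∂P = 0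

/-- The trajectory of `x_{n+1} = f(x_n) + ξ_n B k(x_n) + ξ_n B w_n + γ_n` with initial state `x₀`,
for one realization `ξ`, `γ` of the noise sequences. -/
def traj {N d : ℕ} (f : Vec N → Vec N) (B : Matrix (Fin N) (Fin d) ℝ) (k : Vec N → Vec d)
    (w : ℕ → Vec d) (ξ : ℕ → ℝ) (γ : ℕ → Vec N) (x₀ : Vec N) : ℕ → Vec N
  | 0 => x₀
  | n + 1 =>
    f (traj f B k w ξ γ x₀ n) + ξ n • act B (k (traj f B k w ξ γ x₀ n)) + ξ n • act B (w n) + γ n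

/-- The bound `E ‖x_{n+1} - y_{n+1}‖² ≤ K βⁿ ‖x₀ - y₀‖²` for a fixed exogenous input `w` and a
fixed additive noise `γ`: the two trajectories share `w`, `ξ` and `γ`, and the constants do not
depend on the initial states. -/
def IncrementalDecay {N d : ℕ} {Ω : Type*} [MeasurableSpace Ω] (P : Measure Ω)
    (f : Vec N → Vec N) (B : Matrix (Fin N) (Fin d) ℝ) (k : Vec N → Vec d)
    (ξ : ℕ → Ω → ℝ) (γ : ℕ → Ω → Vec N) (w : ℕ → Vec d) : Prop :=
  ∃ K β : ℝ, 0 < K ∧ 0 < β ∧ β < 1 ∧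
    AEAndZero fun x₀ => ∀ᵐ y₀ ∂(volume : Measure (Vec N)), ∀ n : ℕ,
      ∫⁻ ω, ‖traj f B k w (fun i => ξ i ω) (fun i => γ i ω) x₀ (n + 1) -
          traj f B k w (fun i => ξ i ω) (fun i => γ i ω) y₀ (n + 1)‖ₑ ^ 2 ∂P ≤
        ENNReal.ofReal (K * β ^ n * ‖x₀ - y₀‖ ^ 2)

/-- Mean-square exponential incremental stability of the closed loop: the decay estimate holds for
every deterministic input sequence `w`, both with the additive noise and without it. -/
def MSExpIncrementallyStable {N d : ℕ} {Ω : Type*} [MeasurableSpace Ω] (P : Measure Ω)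
    (f : Vec N → Vec N) (B : Matrix (Fin N) (Fin d) ℝ) (k : Vec N → Vec d)
    (ξ : ℕ → Ω → ℝ) (γ : ℕ → Ω → Vec N) : Prop :=
  ∀ w : ℕ → Vec d,
    IncrementalDecay P f B k ξ γ w ∧ IncrementalDecay P f B k ξ (fun _ _ => 0) w

/-- The initial states whose time averages converge to the space average with respect to `m`, for
every bounded continuous observable. -/
def basin {N : ℕ} (f : Vec N → Vec N) (m : Measure (Vec N)) : Set (Vec N) :=
  {x | ∀ φ : BoundedContinuousFunction (Vec N) ℝ,
    Tendsto (fun n : ℕ => (1 / (n : ℝ)) * ∑ j ∈ Finset.range (n + 1), φ (f^[j] x)) atTop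
      (𝓝 (∫ x, φ x ∂m))}

/-- `m` is the unique physical invariant measure of `x_{n+1} = f(x_n)`: an ergodic invariant
probability measure whose basin is of full Lebesgue measure. -/
structure IsUniquePhysicalMeasure {N : ℕ} (f : Vec N → Vec N) (m : Measure (Vec N)) : Prop where
  isProbabilityMeasure : IsProbabilityMeasure m
  ergodic : Ergodic f m
  basin_full : ∀ᵐ x ∂(volume : Measure (Vec N)), x ∈ basin f m

/-- `Λ` lists the Lyapunov exponents of `f` at `x`, with multiplicity: the matrices
`(Φ_n' Φ_n)^{1/(2n)}`, where `Φ_n = ∂f/∂x (x_n) ⋯ ∂f/∂x (x_0)`, converge to a matrix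
with eigenvalues `exp (Λ i)`. -/
def HasLyapunovExponentsAt {N : ℕ} (f : Vec N → Vec N) (x : Vec N) (Λ : Fin N → ℝ) : Prop :=
  ∃ L : Matrix (Fin N) (Fin N) ℝ,
    Tendsto (fun n : ℕ => cfc (fun t : ℝ => t ^ (1 / (2 * (n : ℝ))))
      ((jacProd f x n).transpose * jacProd f x n)) atTop (𝓝 L) ∧
    L.charpoly.roots = Finset.univ.val.map fun i => Real.exp (Λ i)

/-- `Λ` lists the Lyapunov exponents of `f` with respect to the measure `m`. -/
def HasLyapunovExponents {N : ℕ} (f : Vec N → Vec N) (m : Measure (Vec N)) (Λ : Fin N → ℝ) :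
    Prop :=
  ∀ᵐ x ∂m, HasLyapunovExponentsAt f x Λ

end FadingChannel

end

noncomputable section

namespace FadingChannel

open Matrix

/-! The input `w n = -k (f^[n] x)` cancels the feedback along the open-loop orbit of `x`, so the
noise-free closed loop follows that orbit exactly, while nearby trajectories still feel the random
feedback. Stability bounds differences of trajectories in mean square, hence also their derivative
`D_n`, the product of the factors `A_j + ξ_j B K_j`, where `A_j` and `K_j` are the Jacobians of `f`
and `k` at the `j`-th orbit point. Thus `S_n = E[D_n D_n']` has geometrically decaying trace
(`exists_trace_secondMoment_le`).

Independence gives a linear recursion for `S_n`. With `c = μ² + σ²` and `r = 1 - μ²/c = σ²/c`,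
completing the square yields `S_{n+1} = r A S_n A' + c (BK + (μ/c) A) S_n (BK + (μ/c) A)'`, so
`S_{n+1} ≥ r A S_n A'`. Moreover the quadratic forms of `S_{n+1}` and `A S_n A'` agree on the kernel
of `B'`, so the factor `r` can be lost in at most `d` directions and `det S_{n+1} ≥ r^d det (A S_n
A')` (`pow_mul_det_le_det`, iterated in `recursion_bounds`).

Against the trace decay, these bounds limit the trace and the determinant of `Φ'Φ` along every
open-loop orbit (`exists_jacProd_bounds`). On an orbit typical for `m`, taking `n`-th roots turns
them into bounds on Lyapunov exponents; at the fixed point `0`, `Φ` is a matrix power and the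
eigenvalues enter directly. The determinant gives the case `d < N`, the trace the case `d = N`. -/

/-! ### Inequalities for determinants, traces and powers of semidefinite matrices -/

/-- Relative to `S`, all eigenvalues of `T` are at least `r`, and at most `d` of them are below `1`:
a larger span of such eigenvectors would meet the kernel of `Bᵀ`, which has codimension at most `d`
and on which the two forms agree. -/
theorem pow_mul_det_le_det {N d : ℕ} {S T : Matrix (Fin N) (Fin N) ℝ}
    (B : Matrix (Fin N) (Fin d) ℝ) {r : ℝ} (hr0 : 0 < r) (hr1 : r ≤ 1) (hS : S.PosSemidef)
    (hTS : (T - r • S).PosSemidef)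
    (hker : ∀ z, Bᵀ *ᵥ z = 0 → z ⬝ᵥ (T *ᵥ z) = z ⬝ᵥ (S *ᵥ z)) :
    r ^ d * S.det ≤ T.det := by
  by_cases hdet : S.det = 0
  · have hT : T.PosSemidef := by
      have := hTS.add (hS.smul hr0.le)
      simpa using this
    simpa [hdet] using hT.det_nonneg
  obtain ⟨R, hR⟩ : ∃ R : Matrix (Fin N) (Fin N) ℝ, S = Rᴴ * R := by
    open scoped MatrixOrder in
    exact CStarAlgebra.nonneg_iff_eq_star_mul_self.mp hS.nonneg
  have hRdet : R.det ≠ 0 := fun h => hdet (by rw [hR, det_mul, h, mul_zero])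
  have hRu : IsUnit R.det := isUnit_iff_ne_zero.mpr hRdet
  have hSC : R⁻¹ᴴ * S * R⁻¹ = 1 := by
    rw [hR, Matrix.mul_assoc, Matrix.mul_assoc, mul_nonsing_inv _ hRu, Matrix.mul_one,
      ← conjTranspose_mul, mul_nonsing_inv _ hRu, conjTranspose_one]
  -- `C` is the form `T` in coordinates that turn `S` into the identity, so its eigenvalues are
  -- those of `T` relative to `S`.
  set C := R⁻¹ᴴ * T * R⁻¹ with hC
  have hCr : (C - r • (1 : Matrix (Fin N) (Fin N) ℝ)).PosSemidef := by
    have := hTS.conjTranspose_mul_mul_same R⁻¹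
    rwa [Matrix.mul_sub, Matrix.sub_mul, Matrix.mul_smul, Matrix.smul_mul, hSC] at this
  have hCH : C.IsHermitian := by
    have := (hCr.add (PosSemidef.one.smul hr0.le)).isHermitian
    simpa using this
  have hdetC : T.det = C.det * S.det := by
    have h1 : R⁻¹.det * R.det = 1 := by
      rw [← det_mul, nonsing_inv_mul _ hRu, det_one]
    rw [hC, hR]
    simp only [det_mul, conjTranspose_eq_transpose_of_trivial, det_transpose]
    linear_combination (-T.det * R⁻¹.det * R.det - T.det) * h1
  set U : Matrix (Fin N) (Fin N) ℝ := hCH.eigenvectorUnitary.1 with hU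
  have hUU : Uᴴ * U = 1 := by
    rw [← star_eq_conjTranspose]; exact Unitary.coe_star_mul_self _
  have hUC : Uᴴ * C * U = diagonal hCH.eigenvalues := by
    have h := hCH.conjStarAlgAut_star_eigenvectorUnitary
    rw [Unitary.conjStarAlgAut_apply] at h
    simpa [star_eq_conjTranspose, Function.comp_def] using h
  have hge : ∀ i, r ≤ hCH.eigenvalues i := by
    intro i
    have h := (hCr.conjTranspose_mul_mul_same U).diag_nonneg (i := i)
    rw [Matrix.mul_sub, Matrix.sub_mul, hUC, Matrix.mul_smul, Matrix.smul_mul, Matrix.mul_one,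
      hUU] at h
    simpa using h
  set s : Finset (Fin N) := Finset.univ.filter fun i => hCH.eigenvalues i < 1 with hs
  have hcard : s.card ≤ d := by
    by_contra! hlt
    -- A kernel vector of `F` is a combination of eigenvectors with eigenvalue below `1` that `Bᵀ`
    -- kills in the original coordinates. The target has dimension `d + (N - s.card) < N`, so a
    -- nonzero one exists.
    let M : Matrix (Fin d) (Fin N) ℝ := Bᵀ * R⁻¹ * U
    let F : (Fin N → ℝ) →ₗ[ℝ] (Fin d → ℝ) × ({i // i ∉ s} → ℝ) :=
      M.mulVecLin.prod (LinearMap.funLeft ℝ ℝ Subtype.val)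
    have hF : LinearMap.ker F ≠ ⊥ := by
      apply LinearMap.ker_ne_bot_of_finrank_lt
      have h1 : Fintype.card {i // i ∉ s} = N - s.card := by
        rw [Fintype.card_subtype_compl]; simp
      have h2 : s.card ≤ N := by simpa using s.card_le_univ
      simp only [Module.finrank_prod, Module.finrank_fintype_fun_eq_card, h1, Fintype.card_fin]
      omega
    obtain ⟨c, hc, hc0⟩ := (Submodule.ne_bot_iff _).mp hF
    rw [LinearMap.mem_ker, LinearMap.prod_apply, Prod.ext_iff] at hc
    obtain ⟨hc1, hc2⟩ := hc
    have hcs : ∀ i, i ∉ s → c i = 0 := fun i hi => congrFun hc2 ⟨i, hi⟩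
    have hquad : ∀ X : Matrix (Fin N) (Fin N) ℝ,
        (R⁻¹ *ᵥ (U *ᵥ c)) ⬝ᵥ (X *ᵥ (R⁻¹ *ᵥ (U *ᵥ c))) =
          c ⬝ᵥ ((Uᴴ * (R⁻¹ᴴ * X * R⁻¹) * U) *ᵥ c) := by
      intro X
      simp only [conjTranspose_eq_transpose_of_trivial, ← mulVec_mulVec, dotProduct_mulVec,
        vecMul_transpose]
    have h := hker (R⁻¹ *ᵥ (U *ᵥ c)) (by
      have h : M *ᵥ c = 0 := hc1
      simpa only [M, mulVec_mulVec, Matrix.mul_assoc] using h)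
    rw [hquad, hquad, hSC, ← hC, hUC, Matrix.mul_one, hUU, one_mulVec] at h
    simp only [dotProduct, mulVec_diagonal] at h
    obtain ⟨i, hi⟩ := Function.ne_iff.mp hc0
    refine h.not_lt (Finset.sum_lt_sum (fun j _ => ?_) ⟨i, Finset.mem_univ _, ?_⟩)
    · by_cases hj : j ∈ s
      · have : hCH.eigenvalues j < 1 := by simpa [hs] using hj
        nlinarith [mul_self_nonneg (c j)]
      · simp [hcs j hj]
    · have hmem : i ∈ s := by
        by_contra hcon
        exact hi (hcs i hcon)
      have : hCH.eigenvalues i < 1 := by simpa [hs] using hmem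
      have h2 : 0 < c i * c i := mul_self_pos.mpr hi
      nlinarith
  have hprod : r ^ d ≤ C.det := by
    rw [hCH.det_eq_prod_eigenvalues]
    calc r ^ d ≤ r ^ s.card := pow_le_pow_of_le_one hr0.le hr1 hcard
      _ = ∏ i, if i ∈ s then r else 1 := by simp
      _ ≤ ∏ i, ((hCH.eigenvalues i : ℝ) : ℝ) := by
        refine Finset.prod_le_prod (fun i _ => by split_ifs <;> linarith) fun i _ => ?_
        split_ifs with hi
        · exact hge i
        · simpa [hs] using hi
  rw [hdetC]
  exact mul_le_mul_of_nonneg_right hprod hS.det_nonneg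

theorem eigenvalues_le_trace {N : ℕ} {T : Matrix (Fin N) (Fin N) ℝ} (hT : T.PosSemidef)
    (i : Fin N) : hT.isHermitian.eigenvalues i ≤ T.trace := by
  rw [hT.isHermitian.trace_eq_sum_eigenvalues]
  exact Finset.single_le_sum (f := fun i => hT.isHermitian.eigenvalues i)
    (fun i _ => hT.eigenvalues_nonneg i) (Finset.mem_univ i)

/-- The sharper constant from the arithmetic-geometric mean inequality is not needed: constants
disappear under `n`-th roots. -/
theorem det_le_trace_pow {N : ℕ} {T : Matrix (Fin N) (Fin N) ℝ} (hT : T.PosSemidef) :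
    T.det ≤ T.trace ^ N := by
  rw [hT.isHermitian.det_eq_prod_eigenvalues]
  calc ∏ i, ((hT.isHermitian.eigenvalues i : ℝ) : ℝ) ≤ ∏ _i : Fin N, T.trace :=
        Finset.prod_le_prod (fun i _ => hT.eigenvalues_nonneg i)
          fun i _ => eigenvalues_le_trace hT i
    _ = T.trace ^ N := by simp

/-- The `p`-th power of a positive semidefinite matrix has the
`p`-th power of the determinant as its determinant. -/
theorem det_cfc_rpow {N : ℕ} {H : Matrix (Fin N) (Fin N) ℝ} (hH : H.PosSemidef) (p : ℝ) :
    (cfc (fun t : ℝ => t ^ p) H).det = H.det ^ p := by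
  rw [hH.isHermitian.cfc_eq, IsHermitian.cfc, Unitary.conjStarAlgAut_apply, det_mul, det_mul,
    mul_right_comm, ← det_mul, Unitary.mul_star_self_of_mem (SetLike.coe_mem _), det_one, one_mul, det_diagonal,
    hH.isHermitian.det_eq_prod_eigenvalues]
  exact Real.finsetProd_rpow _ _ (fun i _ => hH.eigenvalues_nonneg i) p

/-- Diagonalize: every eigenvalue of `H` is at most its trace, and `t ↦ t ^ p` is monotone. This
transfers a trace bound to the Rayleigh quotients of the matrices that define the Lyapunov
exponents. -/
theorem dotProduct_cfc_rpow_le {N : ℕ} {H : Matrix (Fin N) (Fin N) ℝ} (hH : H.PosSemidef)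
    {p b : ℝ} (hp : 0 ≤ p) (hb : H.trace ≤ b) (v : Fin N → ℝ) :
    v ⬝ᵥ (cfc (fun t : ℝ => t ^ p) H *ᵥ v) ≤ b ^ p * (v ⬝ᵥ v) := by
  have hD : (diagonal fun i => b ^ p - hH.isHermitian.eigenvalues i ^ p).PosSemidef :=
    PosSemidef.diagonal fun i => sub_nonneg.mpr <| Real.rpow_le_rpow (hH.eigenvalues_nonneg i)
      ((eigenvalues_le_trace hH i).trans hb) hp
  set U : Matrix (Fin N) (Fin N) ℝ := hH.isHermitian.eigenvectorUnitary.1 with hU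
  have hUU : U * Uᴴ = 1 := by
    rw [← star_eq_conjTranspose]; exact Unitary.coe_mul_star_self _
  have hcfc : cfc (fun t : ℝ => t ^ p) H =
      U * diagonal (fun i => hH.isHermitian.eigenvalues i ^ p) * Uᴴ := by
    rw [hH.isHermitian.cfc_eq, IsHermitian.cfc, Unitary.conjStarAlgAut_apply]
    rfl
  have h := (hD.mul_mul_conjTranspose_same U).dotProduct_mulVec_nonneg v
  have heq : (diagonal fun i => b ^ p - hH.isHermitian.eigenvalues i ^ p) =
      b ^ p • (1 : Matrix (Fin N) (Fin N) ℝ) -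
        diagonal fun i => hH.isHermitian.eigenvalues i ^ p := by
    ext i j
    by_cases hij : i = j <;> simp [hij]
  rw [heq, Matrix.mul_sub, Matrix.sub_mul, ← hcfc, Matrix.mul_smul, Matrix.smul_mul,
    Matrix.mul_one, hUU, sub_mulVec, smul_mulVec, one_mulVec] at h
  simp only [star_trivial, dotProduct_sub, dotProduct_smul, smul_eq_mul] at h
  linarith

theorem lt_one_of_pow_le {r C β : ℝ} (hβ0 : 0 ≤ β) (hβ1 : β < 1)
    (h : ∀ n : ℕ, r ^ (n + 1) ≤ C * β ^ n) : r < 1 := by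
  by_contra! hr
  have h1 : Tendsto (fun n : ℕ => C * β ^ n) atTop (𝓝 0) := by
    simpa using (tendsto_pow_atTop_nhds_zero_of_lt_one hβ0 hβ1).const_mul C
  have := ge_of_tendsto' h1 fun n => (one_le_pow₀ hr).trans (h n)
  linarith

theorem exists_eigenvector {K : Type*} [Field K] {N : ℕ} {A : Matrix (Fin N) (Fin N) K} {z : K}
    (hz : z ∈ A.charpoly.roots) : ∃ v : Fin N → K, v ≠ 0 ∧ A *ᵥ v = z • v := by
  have h := (Polynomial.mem_roots'.mp hz).2
  rw [Polynomial.IsRoot.def, eval_charpoly] at h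
  obtain ⟨v, hv, hv0⟩ := exists_mulVec_eq_zero_iff.mpr h
  refine ⟨v, hv, ?_⟩
  rw [sub_mulVec, sub_eq_zero] at hv0
  rw [← hv0]
  simp [scalar_apply, ← smul_one_eq_diagonal, smul_mulVec]

/-! ### Random matrix products and their second moments -/

/-- The product `(A (n-1) + ξ (n-1) F (n-1)) ⋯ (A 0 + ξ 0 F 0)`. -/
def randProd {N : ℕ} (A F : ℕ → Matrix (Fin N) (Fin N) ℝ) (ξ : ℕ → ℝ) :
    ℕ → Matrix (Fin N) (Fin N) ℝ
  | 0 => 1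
  | n + 1 => (A n + ξ n • F n) * randProd A F ξ n

/-- The entrywise expectation of a random matrix. -/
def meanMatrix {N : ℕ} {Ω : Type*} [MeasurableSpace Ω] (P : Measure Ω)
    (X : Ω → Matrix (Fin N) (Fin N) ℝ) : Matrix (Fin N) (Fin N) ℝ :=
  Matrix.of fun i j => ∫ ω, X ω i j ∂P

/-- All entries of a random matrix are integrable. -/
def EntryIntegrable {N : ℕ} {Ω : Type*} [MeasurableSpace Ω] (P : Measure Ω)
    (X : Ω → Matrix (Fin N) (Fin N) ℝ) : Prop :=
  ∀ i j, Integrable (fun ω => X ω i j) P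

section meanMatrix

variable {N : ℕ} {Ω : Type*} [MeasurableSpace Ω] {P : Measure Ω}
  {X Y : Ω → Matrix (Fin N) (Fin N) ℝ}

theorem EntryIntegrable.add (hX : EntryIntegrable P X) (hY : EntryIntegrable P Y) :
    EntryIntegrable P (fun ω => X ω + Y ω) := fun i j => (hX i j).add (hY i j)

theorem meanMatrix_add (hX : EntryIntegrable P X) (hY : EntryIntegrable P Y) :
    meanMatrix P (fun ω => X ω + Y ω) = meanMatrix P X + meanMatrix P Y := by
  ext i j
  exact integral_add (hX i j) (hY i j)

theorem EntryIntegrable.mul_mul (hX : EntryIntegrable P X) (L R : Matrix (Fin N) (Fin N) ℝ) :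
    EntryIntegrable P (fun ω => L * X ω * R) := fun i j => by
  simp only [mul_apply]
  exact integrable_finsetSum _ fun q _ =>
    (integrable_finsetSum _ fun p _ => (hX p q).const_mul _).mul_const _

theorem meanMatrix_mul_mul (hX : EntryIntegrable P X) (L R : Matrix (Fin N) (Fin N) ℝ) :
    meanMatrix P (fun ω => L * X ω * R) = L * meanMatrix P X * R := by
  ext i j
  simp only [meanMatrix, of_apply, mul_apply]
  rw [integral_finsetSum _ fun q _ =>
    (integrable_finsetSum _ fun p _ => (hX p q).const_mul _).mul_const _]
  refine Finset.sum_congr rfl fun q _ => ?_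
  rw [integral_mul_const, integral_finsetSum _ fun p _ => (hX p q).const_mul _]
  simp only [integral_const_mul]

theorem EntryIntegrable.smul_of_indep {g : Ω → ℝ} (hX : EntryIntegrable P X)
    (hg : Integrable g P) (hind : ∀ i j, IndepFun g (fun ω => X ω i j) P) :
    EntryIntegrable P (fun ω => g ω • X ω) := fun i j => (hind i j).integrable_mul hg (hX i j)

theorem meanMatrix_smul_of_indep {g : Ω → ℝ} (hX : EntryIntegrable P X)
    (hg : Integrable g P) (hind : ∀ i j, IndepFun g (fun ω => X ω i j) P) :
    meanMatrix P (fun ω => g ω • X ω) = (∫ ω, g ω ∂P) • meanMatrix P X := by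
  ext i j
  exact (hind i j).integral_fun_mul_eq_mul_integral hg.1 (hX i j).1

end meanMatrix

theorem randProd_congr {N : ℕ} (A F : ℕ → Matrix (Fin N) (Fin N) ℝ) {ξ η : ℕ → ℝ} (n : ℕ)
    (h : ∀ i < n, ξ i = η i) : randProd A F ξ n = randProd A F η n := by
  induction n with
  | zero => rfl
  | succ n ih => rw [randProd, randProd, ih fun i hi => h i (by omega), h n (by omega)]

theorem measurable_randProd_apply {N : ℕ} (A F : ℕ → Matrix (Fin N) (Fin N) ℝ) (n : ℕ) :
    ∀ i j, Measurable fun ξ : ℕ → ℝ => randProd A F ξ n i j := by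
  induction n with
  | zero => intro i j; simp only [randProd]; exact measurable_const
  | succ n ih =>
    intro i j
    simp only [randProd, mul_apply, Matrix.add_apply, Matrix.smul_apply, smul_eq_mul]
    exact Finset.measurable_sum _ fun p _ =>
      (measurable_const.add ((measurable_pi_apply n).mul_const _)).mul (ih p j)

section secondMoment

variable {N : ℕ} {Ω : Type*} [MeasurableSpace Ω] {P : Measure Ω} {ξ : ℕ → Ω → ℝ}

theorem measurable_gram_apply (A F : ℕ → Matrix (Fin N) (Fin N) ℝ) (n : ℕ) (i j : Fin N) :
    Measurable fun ξ : ℕ → ℝ => (randProd A F ξ n * (randProd A F ξ n)ᵀ) i j := by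
  simp only [mul_apply, transpose_apply]
  exact Finset.measurable_sum _ fun p _ =>
    (measurable_randProd_apply A F n i p).mul (measurable_randProd_apply A F n j p)

/-- The first `n` factors involve only the gains with index below `n`. This is what lets the
expectation factor in the second moment recursion. -/
theorem indepFun_gram_apply (hξ : iIndepFun ξ P) (hmeas : ∀ n, Measurable (ξ n))
    (A F : ℕ → Matrix (Fin N) (Fin N) ℝ) (n : ℕ) (i j : Fin N) :
    IndepFun (ξ n) (fun ω => (randProd A F (fun l => ξ l ω) n *
      (randProd A F (fun l => ξ l ω) n)ᵀ) i j) P := by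
  have h := hξ.indepFun_finset {n} (Finset.range n) (by simp) hmeas
  -- Padding by zero writes the product as a measurable function of finitely many gains; the padded
  -- values are never read.
  let e : (Finset.range n → ℝ) → ℕ → ℝ := fun t l => if h : l ∈ Finset.range n then t ⟨l, h⟩ else 0
  have he : Measurable e := by
    refine measurable_pi_lambda _ fun l => ?_
    by_cases hl : l ∈ Finset.range n
    · simp only [e, hl, dite_true]; exact measurable_pi_apply _
    · simp only [e, hl, dite_false]; exact measurable_const
  have h2 := h.comp (measurable_pi_apply (⟨n, by simp⟩ : ({n} : Finset ℕ)))
    ((measurable_gram_apply A F n i j).comp he)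
  convert h2 using 1
  · rfl
  funext ω
  have : randProd A F (fun l => ξ l ω) n = randProd A F (e fun l => ξ l ω) n :=
    randProd_congr A F n fun l hl => by simp [e, hl]
  simp only [Function.comp_apply, this]

/-- The second moment `E[Dₙ Dₙ']` of the random product. -/
def secondMoment (P : Measure Ω) (ξ : ℕ → Ω → ℝ) (A F : ℕ → Matrix (Fin N) (Fin N) ℝ) (n : ℕ) :
    Matrix (Fin N) (Fin N) ℝ :=
  meanMatrix P fun ω => randProd A F (fun l => ξ l ω) n * (randProd A F (fun l => ξ l ω) n)ᵀ

theorem secondMoment_zero [IsProbabilityMeasure P] (A F : ℕ → Matrix (Fin N) (Fin N) ℝ) :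
    secondMoment P ξ A F 0 = 1 := by
  ext i j
  simp [secondMoment, meanMatrix, randProd]

theorem gram_succ (A F : ℕ → Matrix (Fin N) (Fin N) ℝ) (ξ : ℕ → ℝ) (n : ℕ) :
    randProd A F ξ (n + 1) * (randProd A F ξ (n + 1))ᵀ =
      A n * (randProd A F ξ n * (randProd A F ξ n)ᵀ) * (A n)ᵀ +
      (F n * (ξ n • (randProd A F ξ n * (randProd A F ξ n)ᵀ)) * (A n)ᵀ +
       (A n * (ξ n • (randProd A F ξ n * (randProd A F ξ n)ᵀ)) * (F n)ᵀ +
        F n * (ξ n ^ 2 • (randProd A F ξ n * (randProd A F ξ n)ᵀ)) * (F n)ᵀ)) := by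
  simp only [randProd, transpose_mul, transpose_add, transpose_smul, Matrix.add_mul,
    Matrix.mul_add, Matrix.smul_mul, Matrix.mul_smul, smul_add, smul_smul, Matrix.mul_assoc,
    pow_two]
  abel

theorem entryIntegrable_gram [IsProbabilityMeasure P] (hξ : iIndepFun ξ P)
    (hmeas : ∀ n, Measurable (ξ n)) (hLp : ∀ n, MemLp (ξ n) 2 P)
    (A F : ℕ → Matrix (Fin N) (Fin N) ℝ) (n : ℕ) :
    EntryIntegrable P fun ω =>
      randProd A F (fun l => ξ l ω) n * (randProd A F (fun l => ξ l ω) n)ᵀ := by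
  induction n with
  | zero => intro i j; simp only [randProd]; exact integrable_const _
  | succ n ih =>
    have hind := indepFun_gram_apply hξ hmeas A F n
    have hind2 := fun i j => (hind i j).comp (measurable_id.pow_const 2) measurable_id
    have h1 := ih.smul_of_indep ((hLp n).integrable one_le_two) hind
    have h2 := ih.smul_of_indep (hLp n).integrable_sq hind2
    simp only [gram_succ]
    exact (ih.mul_mul _ _).add ((h1.mul_mul _ _).add ((h1.mul_mul _ _).add (h2.mul_mul _ _)))

theorem secondMoment_succ [IsProbabilityMeasure P] (hξ : iIndepFun ξ P)
    (hmeas : ∀ n, Measurable (ξ n)) (hLp : ∀ n, MemLp (ξ n) 2 P) {μ c : ℝ}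
    (hmean : ∀ n, ∫ ω, ξ n ω ∂P = μ) (hsq : ∀ n, ∫ ω, ξ n ω ^ 2 ∂P = c)
    (A F : ℕ → Matrix (Fin N) (Fin N) ℝ) (n : ℕ) :
    secondMoment P ξ A F (n + 1) =
      A n * secondMoment P ξ A F n * (A n)ᵀ +
      (F n * (μ • secondMoment P ξ A F n) * (A n)ᵀ +
       (A n * (μ • secondMoment P ξ A F n) * (F n)ᵀ +
        F n * (c • secondMoment P ξ A F n) * (F n)ᵀ)) := by
  have ih := entryIntegrable_gram hξ hmeas hLp A F n
  have hind := indepFun_gram_apply hξ hmeas A F n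
  have hind2 := fun i j => (hind i j).comp (measurable_id.pow_const 2) measurable_id
  have h1 := ih.smul_of_indep ((hLp n).integrable one_le_two) hind
  have h2 := ih.smul_of_indep (hLp n).integrable_sq hind2
  have e1 := meanMatrix_smul_of_indep ih ((hLp n).integrable one_le_two) hind
  have e2 := meanMatrix_smul_of_indep ih (hLp n).integrable_sq hind2
  rw [hmean] at e1
  rw [hsq] at e2
  conv_lhs => rw [secondMoment]
  simp only [gram_succ]
  rw [meanMatrix_add (ih.mul_mul _ _) ((h1.mul_mul _ _).add ((h1.mul_mul _ _).add
      (h2.mul_mul _ _))), meanMatrix_add (h1.mul_mul _ _) ((h1.mul_mul _ _).add (h2.mul_mul _ _)),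
    meanMatrix_add (h1.mul_mul _ _) (h2.mul_mul _ _), meanMatrix_mul_mul ih,
    meanMatrix_mul_mul h1, meanMatrix_mul_mul h1, meanMatrix_mul_mul h2, e1, e2]
  rfl

end secondMoment

/-! ### Lower bounds for the second moments -/

/-- The deterministic Riccati-type lower bounds on a matrix sequence obeying the second moment
recursion; `c` is the second moment of the gain. -/
theorem recursion_bounds {N d : ℕ} {S : ℕ → Matrix (Fin N) (Fin N) ℝ}
    {A : ℕ → Matrix (Fin N) (Fin N) ℝ} {B : Matrix (Fin N) (Fin d) ℝ}
    {K : ℕ → Matrix (Fin d) (Fin N) ℝ} {μ c : ℝ} (hc : 0 < c) (hμc : μ ^ 2 < c)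
    (h0 : S 0 = 1)
    (hS : ∀ n, S (n + 1) = A n * S n * (A n)ᵀ + ((B * K n) * (μ • S n) * (A n)ᵀ +
      (A n * (μ • S n) * (B * K n)ᵀ + (B * K n) * (c • S n) * (B * K n)ᵀ))) (n : ℕ) :
    (S n - (1 - μ ^ 2 / c) ^ n • (randProd A 0 0 n * (randProd A 0 0 n)ᵀ)).PosSemidef ∧
      ((1 - μ ^ 2 / c) ^ d) ^ n * (randProd A 0 0 n).det ^ 2 ≤ (S n).det := by
  set r := 1 - μ ^ 2 / c with hr
  have hr0 : 0 < r := by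
    rw [hr, sub_pos, div_lt_one hc]; exact hμc
  have hr1 : r ≤ 1 := by
    rw [hr]; linarith [div_nonneg (sq_nonneg μ) hc.le]
  induction n with
  | zero => simp [h0, randProd, PosSemidef.zero]
  | succ n ih =>
    obtain ⟨ih1, ih2⟩ := ih
    have hG : (randProd A 0 0 n * (randProd A 0 0 n)ᵀ).PosSemidef := by
      rw [← conjTranspose_eq_transpose_of_trivial]
      exact posSemidef_self_mul_conjTranspose _
    have hSn : (S n).PosSemidef := by
      have := ih1.add (hG.smul (pow_nonneg hr0.le n))
      simpa using this
    have hstep : (S (n + 1) - r • (A n * S n * (A n)ᵀ)).PosSemidef := by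
      -- Completing the square: the shift `μ / c` absorbs both cross terms and leaves exactly `(1 -
      -- μ ^ 2 / c) A S A'`.
      have h := (hSn.mul_mul_conjTranspose_same (B * K n + (μ / c) • A n)).smul hc.le
      rw [conjTranspose_eq_transpose_of_trivial] at h
      convert h using 1
      rw [hS, hr]
      simp only [transpose_add, transpose_smul, Matrix.add_mul, Matrix.mul_add, Matrix.smul_mul,
        Matrix.mul_smul, smul_add, smul_smul, sub_smul, one_smul]
      have e1 : c * (μ / c) = μ := by field_simp
      have e2 : c * (μ / c * (μ / c)) = μ ^ 2 / c := by field_simp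
      rw [e1, e2]
      abel
    have hrp : randProd A 0 0 (n + 1) = A n * randProd A 0 0 n := by simp [randProd]
    refine ⟨?_, ?_⟩
    · have h := hstep.add ((ih1.mul_mul_conjTranspose_same (A n)).smul hr0.le)
      rw [conjTranspose_eq_transpose_of_trivial] at h
      convert h using 1
      rw [hrp, transpose_mul, Matrix.mul_sub, Matrix.sub_mul, smul_sub, Matrix.mul_smul,
        Matrix.smul_mul, smul_smul, ← pow_succ']
      simp only [Matrix.mul_assoc]
      abel
    · have hASA : (A n * S n * (A n)ᵀ).PosSemidef := by
        rw [← conjTranspose_eq_transpose_of_trivial]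
        exact hSn.mul_mul_conjTranspose_same (A n)
      have h := pow_mul_det_le_det B hr0 hr1 hASA hstep ?_
      · refine le_trans ?_ h
        rw [hrp]
        simp only [det_mul, det_transpose]
        have hpos : 0 ≤ r ^ d * (A n).det ^ 2 := by positivity
        calc _ = r ^ d * (A n).det ^ 2 * ((r ^ d) ^ n * (randProd A 0 0 n).det ^ 2) := by ring
          _ ≤ _ := mul_le_mul_of_nonneg_left ih2 hpos
          _ = _ := by ring
      -- Every term of the recursion other than `A S A'` has a factor `B` on the left or `Bᵀ` on the
      -- right, hence vanishes on `z`.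
      · intro z hz
        rw [hS]
        have hz' : z ᵥ* B = 0 := by rwa [← mulVec_transpose]
        simp only [transpose_mul, ← mulVec_mulVec, add_mulVec, dotProduct_add, hz, mulVec_zero,
          add_zero, dotProduct_mulVec, hz', zero_vecMul, zero_dotProduct]

/-! ### Linearization of the closed loop along open-loop orbits -/

theorem fderiv_apply_eq_jac_mulVec {N M : ℕ} (g : Vec N → Vec M) (x v : Vec N) :
    fderiv ℝ g x v = WithLp.toLp 2 (jac g x *ᵥ v.ofLp) := by
  have hv : v = ∑ j, v j • EuclideanSpace.single j (1 : ℝ) := by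
    ext i
    simp [Pi.single_apply]
  conv_lhs => rw [hv, map_sum]
  ext i
  simp [jac, mulVec, dotProduct, mul_comm]

/-- The action of a matrix on Euclidean vectors as a continuous linear map. -/
def actCLM {N d : ℕ} (B : Matrix (Fin N) (Fin d) ℝ) : Vec d →L[ℝ] Vec N :=
  LinearMap.toContinuousLinearMap
    { toFun := act B
      map_add' := fun u v => by simp [act, mulVec_add]
      map_smul' := fun c u => by simp [act, mulVec_smul] }

theorem actCLM_apply {N d : ℕ} (B : Matrix (Fin N) (Fin d) ℝ) (u : Vec d) :
    actCLM B u = act B u := rfl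

section traj

variable {N d : ℕ} {f : Vec N → Vec N} {k : Vec N → Vec d} (B : Matrix (Fin N) (Fin d) ℝ)

theorem continuous_traj (hf : Continuous f) (hk : Continuous k) (w : ℕ → Vec d) (ξ : ℕ → ℝ)
    (γ : ℕ → Vec N) (n : ℕ) : Continuous fun x => traj f B k w ξ γ x n := by
  induction n with
  | zero => exact continuous_id
  | succ n ih =>
    simp only [traj, ← actCLM_apply]
    fun_prop

theorem measurable_traj {Ω : Type*} [MeasurableSpace Ω] (hf : Continuous f) (hk : Continuous k)
    (w : ℕ → Vec d) {ξ : ℕ → Ω → ℝ} (hξ : ∀ n, Measurable (ξ n)) {γ : ℕ → Ω → Vec N}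
    (hγ : ∀ n, Measurable (γ n)) (x : Vec N) (n : ℕ) :
    Measurable fun ω => traj f B k w (fun i => ξ i ω) (fun i => γ i ω) x n := by
  induction n with
  | zero => exact measurable_const
  | succ n ih =>
    simp only [traj, ← actCLM_apply]
    have h1 := hf.measurable.comp ih
    have h2 := (actCLM B).continuous.measurable.comp (hk.measurable.comp ih)
    exact ((h1.add ((hξ n).smul h2)).add ((hξ n).smul measurable_const)).add (hγ n)

/-- The input that cancels the feedback along the open loop orbit of `x`. -/
theorem traj_cancel (ξ : ℕ → ℝ) (x : Vec N) (n : ℕ) :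
    traj f B k (fun n => -k (f^[n] x)) ξ (fun _ => 0) x n = f^[n] x := by
  induction n with
  | zero => rfl
  | succ n ih =>
    simp only [traj, ih, Function.iterate_succ_apply', ← actCLM_apply, map_neg]
    simp

/-- Chain rule. At `t = 0` the trajectory is the open-loop orbit, so the Jacobians are evaluated
there whatever the gains are; the cancelling input does not depend on `t` and drops out. -/
theorem hasDerivAt_traj (hf : ContDiff ℝ 1 f) (hk : ContDiff ℝ 1 k) (ξ : ℕ → ℝ) (x v : Vec N)
    (n : ℕ) :
    HasDerivAt (fun t : ℝ => traj f B k (fun n => -k (f^[n] x)) ξ (fun _ => 0) (x + t • v) n)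
      (WithLp.toLp 2 (randProd (fun n => jac f (f^[n] x)) (fun n => B * jac k (f^[n] x)) ξ n *ᵥ
        v.ofLp)) 0 := by
  induction n with
  | zero =>
    simp only [traj, randProd, one_mulVec]
    simpa using ((hasDerivAt_id (0 : ℝ)).smul_const v).const_add x
  | succ n ih =>
    have hx : traj f B k (fun n => -k (f^[n] x)) ξ (fun _ => 0) (x + (0 : ℝ) • v) n = f^[n] x := by
      rw [zero_smul, add_zero, traj_cancel]
    have hfd : HasFDerivAt f (fderiv ℝ f (f^[n] x))
        (traj f B k (fun n => -k (f^[n] x)) ξ (fun _ => 0) (x + (0 : ℝ) • v) n) := by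
      rw [hx]; exact (hf.differentiable one_ne_zero _).hasFDerivAt
    have hkd : HasFDerivAt k (fderiv ℝ k (f^[n] x))
        (traj f B k (fun n => -k (f^[n] x)) ξ (fun _ => 0) (x + (0 : ℝ) • v) n) := by
      rw [hx]; exact (hk.differentiable one_ne_zero _).hasFDerivAt
    have h1 := hfd.comp_hasDerivAt (0 : ℝ) ih
    have h2 := (actCLM B).hasFDerivAt.comp_hasDerivAt (0 : ℝ) (hkd.comp_hasDerivAt (0 : ℝ) ih)
    have h := ((h1.add (h2.const_smul (ξ n))).add_const
      (ξ n • act B (-k (f^[n] x)))).add_const (0 : Vec N)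
    simp only [traj]
    refine HasDerivAt.congr_deriv h ?_
    simp only [fderiv_apply_eq_jac_mulVec, actCLM_apply, act, randProd]
    rw [← WithLp.toLp_smul, ← WithLp.toLp_add]
    simp only [← mulVec_mulVec, add_mulVec, smul_mulVec]

end traj

/-! ### From incremental stability to decay of the second moments -/

section decay

variable {N d : ℕ} {Ω : Type*} [MeasurableSpace Ω] {P : Measure Ω}
  {f : Vec N → Vec N} {k : Vec N → Vec d} {B : Matrix (Fin N) (Fin d) ℝ} {ξ : ℕ → Ω → ℝ}
  {γ : ℕ → Ω → Vec N} {w : ℕ → Vec d}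

/-- By Fatou's lemma the pairs of initial states that satisfy a decay bound form a closed set. -/
theorem isClosed_decay (hf : Continuous f) (hk : Continuous k) (hξ : ∀ n, Measurable (ξ n))
    (hγ : ∀ n, Measurable (γ n)) (C : ℝ) (n : ℕ) :
    IsClosed {p : Vec N × Vec N |
      ∫⁻ ω, ‖traj f B k w (fun i => ξ i ω) (fun i => γ i ω) p.1 n -
        traj f B k w (fun i => ξ i ω) (fun i => γ i ω) p.2 n‖ₑ ^ 2 ∂P ≤
          ENNReal.ofReal (C * ‖p.1 - p.2‖ ^ 2)} := by
  refine IsSeqClosed.isClosed fun p q hp hpq => ?_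
  have hlim : ∀ ω, Tendsto (fun i => ‖traj f B k w (fun i => ξ i ω) (fun i => γ i ω) (p i).1 n -
        traj f B k w (fun i => ξ i ω) (fun i => γ i ω) (p i).2 n‖ₑ ^ 2) atTop
      (𝓝 (‖traj f B k w (fun i => ξ i ω) (fun i => γ i ω) q.1 n -
        traj f B k w (fun i => ξ i ω) (fun i => γ i ω) q.2 n‖ₑ ^ 2)) := fun ω => by
    have hc := continuous_traj B hf hk w (fun i => ξ i ω) (fun i => γ i ω) n
    have hc2 : Continuous fun p : Vec N × Vec N =>
        ‖traj f B k w (fun i => ξ i ω) (fun i => γ i ω) p.1 n -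
          traj f B k w (fun i => ξ i ω) (fun i => γ i ω) p.2 n‖ₑ ^ 2 :=
      (ENNReal.continuous_pow 2).comp
        (continuous_enorm.comp ((hc.comp continuous_fst).sub (hc.comp continuous_snd)))
    exact (hc2.tendsto q).comp hpq
  have hr : Tendsto (fun i => ENNReal.ofReal (C * ‖(p i).1 - (p i).2‖ ^ 2)) atTop
      (𝓝 (ENNReal.ofReal (C * ‖q.1 - q.2‖ ^ 2))) := by
    have hc2 : Continuous fun p : Vec N × Vec N => ENNReal.ofReal (C * ‖p.1 - p.2‖ ^ 2) :=
      ENNReal.continuous_ofReal.comp (by fun_prop)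
    exact (hc2.tendsto q).comp hpq
  have hmeas : ∀ i, Measurable fun ω => ‖traj f B k w (fun i => ξ i ω) (fun i => γ i ω) (p i).1 n -
        traj f B k w (fun i => ξ i ω) (fun i => γ i ω) (p i).2 n‖ₑ ^ 2 := fun i =>
    ((measurable_traj B hf hk w hξ hγ _ n).sub
      (measurable_traj B hf hk w hξ hγ _ n)).enorm.pow_const 2
  calc _ = ∫⁻ ω, liminf (fun i => ‖traj f B k w (fun i => ξ i ω) (fun i => γ i ω) (p i).1 n -
        traj f B k w (fun i => ξ i ω) (fun i => γ i ω) (p i).2 n‖ₑ ^ 2) atTop ∂P :=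
        lintegral_congr fun ω => (hlim ω).liminf_eq.symm
    _ ≤ _ := lintegral_liminf_le hmeas
    _ ≤ liminf (fun i => ENNReal.ofReal (C * ‖(p i).1 - (p i).2‖ ^ 2)) atTop :=
        liminf_le_liminf (Eventually.of_forall hp)
    _ = _ := hr.liminf_eq

/-- The decay bound holds for all initial states. -/
theorem IncrementalDecay.forall (hf : Continuous f) (hk : Continuous k)
    (hξ : ∀ n, Measurable (ξ n)) (hγ : ∀ n, Measurable (γ n))
    (h : IncrementalDecay P f B k ξ γ w) :
    ∃ K β : ℝ, 0 < K ∧ 0 < β ∧ β < 1 ∧ ∀ (n : ℕ) (x y : Vec N),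
      ∫⁻ ω, ‖traj f B k w (fun i => ξ i ω) (fun i => γ i ω) x (n + 1) -
          traj f B k w (fun i => ξ i ω) (fun i => γ i ω) y (n + 1)‖ₑ ^ 2 ∂P ≤
        ENNReal.ofReal (K * β ^ n * ‖x - y‖ ^ 2) := by
  obtain ⟨K, β, hK, hβ0, hβ1, hae, -⟩ := h
  refine ⟨K, β, hK, hβ0, hβ1, fun n x y => ?_⟩
  have hcl := isClosed_decay (P := P) (B := B) (w := w) hf hk hξ hγ (K * β ^ n) (n + 1)
  have hx : ∀ᵐ x ∂(volume : Measure (Vec N)), ∀ y, (x, y) ∈ {p : Vec N × Vec N |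
      ∫⁻ ω, ‖traj f B k w (fun i => ξ i ω) (fun i => γ i ω) p.1 (n + 1) -
        traj f B k w (fun i => ξ i ω) (fun i => γ i ω) p.2 (n + 1)‖ₑ ^ 2 ∂P ≤
          ENNReal.ofReal (K * β ^ n * ‖p.1 - p.2‖ ^ 2)} := by
    -- A set of full Lebesgue measure is dense, and the decay condition is closed: extend first in
    -- `y` for almost every fixed `x`, then in `x`.
    filter_upwards [hae] with x hx y
    have hd : Dense {y | ∀ n : ℕ, ∫⁻ ω, ‖traj f B k w (fun i => ξ i ω) (fun i => γ i ω) x (n + 1) -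
          traj f B k w (fun i => ξ i ω) (fun i => γ i ω) y (n + 1)‖ₑ ^ 2 ∂P ≤
        ENNReal.ofReal (K * β ^ n * ‖x - y‖ ^ 2)} := Measure.dense_of_ae hx
    exact hd.induction (P := fun y => (x, y) ∈ _) (fun y hy => hy n)
      (hcl.preimage (Continuous.prodMk_right x)) y
  exact (Measure.dense_of_ae hx).induction (P := fun x => (x, y) ∈ _) (fun x hx => hx y)
      (hcl.preimage (Continuous.prodMk_left y)) x

/-- A mean square Lipschitz bound passes to directional derivatives. -/
theorem lintegral_deriv_le {E : Type*} [NormedAddCommGroup E] [NormedSpace ℝ E]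
    [MeasurableSpace E] [BorelSpace E] [SecondCountableTopology E] {T : E → Ω → E} {D : Ω → E}
    {x v : E} (hT : ∀ y, Measurable (T y))
    (hD : ∀ ω, HasDerivAt (fun t : ℝ => T (x + t • v) ω) (D ω) 0) {C : ℝ}
    (h : ∀ y, ∫⁻ ω, ‖T y ω - T x ω‖ₑ ^ 2 ∂P ≤ ENNReal.ofReal (C * ‖y - x‖ ^ 2)) :
    ∫⁻ ω, ‖D ω‖ₑ ^ 2 ∂P ≤ ENNReal.ofReal (C * ‖v‖ ^ 2) := by
  -- Difference quotients along this sequence converge for each `ω` and satisfy the bound uniformly,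
  -- so Fatou's lemma applies.
  let t : ℕ → ℝ := fun i => 1 / ((i : ℝ) + 1)
  have ht0 : ∀ i, 0 < t i := fun i => Nat.one_div_pos_of_nat
  have ht : Tendsto t atTop (𝓝[≠] 0) :=
    tendsto_nhdsWithin_iff.mpr ⟨tendsto_one_div_add_atTop_nhds_zero_nat,
      Eventually.of_forall fun i => (ht0 i).ne'⟩
  have hlim : ∀ ω, Tendsto (fun i => ‖(t i)⁻¹ • (T (x + t i • v) ω - T x ω)‖ₑ ^ 2) atTop
      (𝓝 (‖D ω‖ₑ ^ 2)) := fun ω => by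
    have h1 := (hD ω).tendsto_slope_zero.comp ht
    simp only [zero_add, zero_smul, add_zero] at h1
    exact ((ENNReal.continuous_pow 2).tendsto _).comp ((continuous_enorm.tendsto _).comp h1)
  have hmeas : ∀ i, Measurable fun ω => ‖(t i)⁻¹ • (T (x + t i • v) ω - T x ω)‖ₑ ^ 2 := fun i =>
    (((hT _).sub (hT _)).const_smul _).enorm.pow_const 2
  have hbound : ∀ i, ∫⁻ ω, ‖(t i)⁻¹ • (T (x + t i • v) ω - T x ω)‖ₑ ^ 2 ∂P ≤
      ENNReal.ofReal (C * ‖v‖ ^ 2) := fun i => by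
    simp only [enorm_smul, mul_pow]
    rw [lintegral_const_mul' _ _ (by simp)]
    refine (mul_le_mul_right (h (x + t i • v)) _).trans_eq ?_
    rw [← ofReal_norm, ← ENNReal.ofReal_pow (norm_nonneg _), ← ENNReal.ofReal_mul (by positivity)]
    congr 1
    have h3 : ‖t i‖ ≠ 0 := norm_ne_zero_iff.mpr (ht0 i).ne'
    rw [add_sub_cancel_left, norm_smul, norm_inv, mul_pow]
    field_simp
  calc _ = ∫⁻ ω, liminf (fun i => ‖(t i)⁻¹ • (T (x + t i • v) ω - T x ω)‖ₑ ^ 2) atTop ∂P :=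
        lintegral_congr fun ω => (hlim ω).liminf_eq.symm
    _ ≤ _ := lintegral_liminf_le hmeas
    _ ≤ liminf (fun _ : ℕ => ENNReal.ofReal (C * ‖v‖ ^ 2)) atTop :=
        liminf_le_liminf (Eventually.of_forall hbound)
    _ = _ := liminf_const _

/-- The trace of `D D'` is the sum of `‖D e_j‖²` over the standard basis, and each of these `N`
terms has expectation at most `C`. -/
theorem trace_secondMoment_le {A F : ℕ → Matrix (Fin N) (Fin N) ℝ} {C : ℝ} (hC : 0 ≤ C) (n : ℕ)
    (hint : EntryIntegrable P fun ω =>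
      randProd A F (fun l => ξ l ω) n * (randProd A F (fun l => ξ l ω) n)ᵀ)
    (hmeas : ∀ n, Measurable (ξ n))
    (h : ∀ v : Vec N, ∫⁻ ω, ‖WithLp.toLp 2 (randProd A F (fun i => ξ i ω) n *ᵥ v.ofLp)‖ₑ ^ 2 ∂P ≤
      ENNReal.ofReal (C * ‖v‖ ^ 2)) :
    (secondMoment P ξ A F n).trace ≤ N * C := by
  have hsum : ∀ ω, ENNReal.ofReal
      ((randProd A F (fun l => ξ l ω) n * (randProd A F (fun l => ξ l ω) n)ᵀ).trace) =
      ∑ j, ‖WithLp.toLp 2 (randProd A F (fun i => ξ i ω) n *ᵥ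
        (EuclideanSpace.single j (1 : ℝ)).ofLp)‖ₑ ^ 2 := fun ω => by
    have e : ∀ u : Vec N, ‖u‖ₑ ^ 2 = ENNReal.ofReal (∑ i, u i ^ 2) := fun u => by
      rw [← ofReal_norm, ← ENNReal.ofReal_pow (norm_nonneg _),
        EuclideanSpace.norm_sq_eq]
      simp
    simp only [e]
    rw [← ENNReal.ofReal_sum_of_nonneg fun _ _ => Finset.sum_nonneg fun _ _ => sq_nonneg _,
      Finset.sum_comm]
    congr 1
    simp [trace, mul_apply, pow_two]
  have htr : (secondMoment P ξ A F n).trace = ∫ ω,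
      (randProd A F (fun l => ξ l ω) n * (randProd A F (fun l => ξ l ω) n)ᵀ).trace ∂P := by
    simp only [trace, diag_apply]
    rw [integral_finsetSum _ fun i _ => hint i i]
    rfl
  have htri : Integrable (fun ω =>
      (randProd A F (fun l => ξ l ω) n * (randProd A F (fun l => ξ l ω) n)ᵀ).trace) P := by
    simp only [trace, diag_apply]
    exact integrable_finsetSum _ fun i _ => hint i i
  have hnn : ∀ ω, 0 ≤
      (randProd A F (fun l => ξ l ω) n * (randProd A F (fun l => ξ l ω) n)ᵀ).trace := fun ω => by
    rw [← conjTranspose_eq_transpose_of_trivial]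
    exact (posSemidef_self_mul_conjTranspose _).trace_nonneg
  rw [← ENNReal.ofReal_le_ofReal_iff (by positivity), htr,
    ofReal_integral_eq_lintegral_ofReal htri (Eventually.of_forall hnn)]
  simp only [hsum]
  have hm : ∀ j, Measurable fun ω => ‖WithLp.toLp 2 (randProd A F (fun i => ξ i ω) n *ᵥ
        (EuclideanSpace.single j (1 : ℝ)).ofLp)‖ₑ ^ 2 := fun j => by
    refine Measurable.pow_const (Measurable.enorm ?_) 2
    refine (PiLp.continuous_toLp 2 _).measurable.comp (measurable_pi_lambda _ fun i => ?_)
    simp only [mulVec, dotProduct]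
    exact Finset.measurable_sum _ fun p _ => (((measurable_randProd_apply A F n i p).comp
      (measurable_pi_lambda _ fun l => hmeas l)).mul_const _)
  rw [lintegral_finsetSum _ fun j _ => hm j]
  calc _ ≤ ∑ _j : Fin N, ENNReal.ofReal C := Finset.sum_le_sum fun j _ => by
        simpa using h (EuclideanSpace.single j 1)
    _ = ENNReal.ofReal (N * C) := by
        simp [ENNReal.ofReal_mul]

/-- Stability bounds the second moments of the linearization along every open loop orbit. -/
theorem exists_trace_secondMoment_le [IsProbabilityMeasure P] (hf : ContDiff ℝ 1 f)
    (hk : ContDiff ℝ 1 k) (hind : iIndepFun ξ P) (hmeas : ∀ n, Measurable (ξ n))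
    (hLp : ∀ n, MemLp (ξ n) 2 P) (x : Vec N)
    (h : IncrementalDecay P f B k ξ (fun _ _ => 0) fun n => -k (f^[n] x)) :
    ∃ C β : ℝ, 0 < β ∧ β < 1 ∧ ∀ n : ℕ,
      (secondMoment P ξ (fun n => jac f (f^[n] x)) (fun n => B * jac k (f^[n] x)) (n + 1)).trace ≤
        C * β ^ n := by
  obtain ⟨K, β, hK, hβ0, hβ1, hb⟩ :=
    h.forall hf.continuous hk.continuous hmeas fun _ => measurable_const
  refine ⟨N * K, β, hβ0, hβ1, fun n => ?_⟩
  rw [mul_assoc]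
  refine trace_secondMoment_le (by positivity) _ (entryIntegrable_gram hind hmeas hLp _ _ _) hmeas
    fun v => ?_
  exact lintegral_deriv_le
    (fun y => measurable_traj B hf.continuous hk.continuous _ hmeas (fun _ => measurable_const) y _)
    (fun ω => hasDerivAt_traj B hf hk _ x v (n + 1)) fun y => hb n y x

end decay

/-! ### Growth of the Jacobian products along open-loop orbits -/

theorem randProd_eq_jacProd {N : ℕ} (f : Vec N → Vec N) (x : Vec N) (n : ℕ) :
    randProd (fun n => jac f (f^[n] x)) 0 0 (n + 1) = jacProd f x n := by
  induction n with
  | zero => simp [randProd, jacProd]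
  | succ n ih => rw [randProd, ih]; simp [jacProd]

theorem jacProd_of_fixed {N : ℕ} {f : Vec N → Vec N} {x : Vec N} (hx : f x = x) (n : ℕ) :
    jacProd f x n = jac f x ^ (n + 1) := by
  induction n with
  | zero => simp [jacProd]
  | succ n ih => rw [jacProd, ih, Function.iterate_fixed hx, ← pow_succ']

theorem ChannelNoise.memLp_all {Ω : Type*} [MeasurableSpace Ω] {P : Measure Ω} {μ σ : ℝ}
    {ξ : ℕ → Ω → ℝ} (h : ChannelNoise P μ σ ξ) (n : ℕ) : MemLp (ξ n) 2 P :=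
  (h.iid.identDistrib n).memLp_iff.mpr h.memLp

theorem ChannelNoise.integral_eq {Ω : Type*} [MeasurableSpace Ω] {P : Measure Ω} {μ σ : ℝ}
    {ξ : ℕ → Ω → ℝ} (h : ChannelNoise P μ σ ξ) (n : ℕ) : ∫ ω, ξ n ω ∂P = μ :=
  (h.iid.identDistrib n).integral_eq.trans h.mean

theorem ChannelNoise.integral_sq {Ω : Type*} [MeasurableSpace Ω] {P : Measure Ω}
    [IsProbabilityMeasure P] {μ σ : ℝ} {ξ : ℕ → Ω → ℝ} (h : ChannelNoise P μ σ ξ) (n : ℕ) :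
    ∫ ω, ξ n ω ^ 2 ∂P = μ ^ 2 + σ ^ 2 := by
  have h1 : ∫ ω, ξ n ω ^ 2 ∂P = ∫ ω, ξ 0 ω ^ 2 ∂P :=
    ((h.iid.identDistrib n).comp (measurable_id.pow_const 2)).integral_eq
  have hi := h.memLp.integrable one_le_two
  have h2 : ∫ ω, ξ 0 ω ^ 2 ∂P =
      ∫ ω, ((ξ 0 ω - μ) ^ 2 + (2 * μ * ξ 0 ω - μ ^ 2)) ∂P := by
    congr 1; funext ω; ring
  have h3 : Integrable (fun ω => (ξ 0 ω - μ) ^ 2) P :=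
    (h.memLp.sub (memLp_const μ)).integrable_sq
  have h4 : Integrable (fun ω => 2 * μ * ξ 0 ω - μ ^ 2) P :=
    (hi.const_mul _).sub (integrable_const _)
  rw [h1, h2, integral_add h3 h4, integral_sub (hi.const_mul _) (integrable_const _), integral_const_mul, h.mean, h.variance]
  simp
  ring

/-- Stability of the closed loop limits the growth of the Jacobians along open loop orbits. -/
theorem exists_jacProd_bounds {N d : ℕ} {Ω : Type*} [MeasurableSpace Ω] {P : Measure Ω}
    [IsProbabilityMeasure P] {f : Vec N → Vec N} {k : Vec N → Vec d}
    {B : Matrix (Fin N) (Fin d) ℝ} {ξ : ℕ → Ω → ℝ} {μ σ : ℝ} (hf : ContDiff ℝ 1 f)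
    (hk : ContDiff ℝ 1 k) (hξ : ChannelNoise P μ σ ξ) (x : Vec N)
    (h : IncrementalDecay P f B k ξ (fun _ _ => 0) fun n => -k (f^[n] x)) :
    ∃ C β : ℝ, 0 < C ∧ 0 < β ∧ β < 1 ∧ ∀ n : ℕ,
      (1 - μ ^ 2 / (μ ^ 2 + σ ^ 2)) ^ (n + 1) * ((jacProd f x n)ᵀ * jacProd f x n).trace ≤
        C * β ^ n ∧
      ((1 - μ ^ 2 / (μ ^ 2 + σ ^ 2)) ^ d) ^ (n + 1) * ((jacProd f x n)ᵀ * jacProd f x n).det ≤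
        C ^ N * (β ^ N) ^ n := by
  obtain ⟨C, β, hβ0, hβ1, hb⟩ := exists_trace_secondMoment_le hf hk hξ.iid.indep hξ.iid.measurable
    hξ.memLp_all x h
  have hσ : 0 < σ ^ 2 := sq_pos_of_ne_zero hξ.sigma_ne_zero
  have hc : 0 < μ ^ 2 + σ ^ 2 := by positivity
  have hμc : μ ^ 2 < μ ^ 2 + σ ^ 2 := by linarith
  have hr0 : 0 < 1 - μ ^ 2 / (μ ^ 2 + σ ^ 2) := by
    rw [sub_pos, div_lt_one hc]; exact hμc
  -- The constant has to be positive so that its `n`-th roots tend to `1`.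
  refine ⟨max C 1, β, by positivity, hβ0, hβ1, fun n => ?_⟩
  obtain ⟨h1, h2⟩ := recursion_bounds (B := B) (K := fun n => jac k (f^[n] x)) hc hμc
    (secondMoment_zero (P := P) (ξ := ξ) (fun n => jac f (f^[n] x))
      (fun n => B * jac k (f^[n] x)))
    (secondMoment_succ hξ.iid.indep hξ.iid.measurable hξ.memLp_all hξ.integral_eq hξ.integral_sq
      _ _) (n + 1)
  rw [randProd_eq_jacProd] at h1 h2
  have hG : (jacProd f x n * (jacProd f x n)ᵀ).PosSemidef := by
    rw [← conjTranspose_eq_transpose_of_trivial]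
    exact posSemidef_self_mul_conjTranspose _
  have hS := h1.add (hG.smul (pow_nonneg hr0.le (n + 1)))
  rw [sub_add_cancel] at hS
  have htr := (hb n).trans (mul_le_mul_of_nonneg_right (le_max_left C 1) (pow_nonneg hβ0.le n))
  constructor
  · have h3 := h1.trace_nonneg
    rw [trace_sub, trace_smul, smul_eq_mul, trace_mul_comm] at h3
    linarith
  · rw [det_mul, det_transpose, ← pow_two]
    calc _ ≤ _ := h2
      _ ≤ _ := det_le_trace_pow hS
      _ ≤ (max C 1 * β ^ n) ^ N := pow_le_pow_left₀ hS.trace_nonneg htr N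
      _ = _ := by rw [mul_pow, ← pow_mul, ← pow_mul, mul_comm n N]

/-! ### Passage to Lyapunov exponents -/

/-- The `n`-th root of `h` reads `q * q ^ (1/n) * a n ^ (1/n) ≤ C ^ (1/n) * b`; here `a n ^ (1/n)`
dominates `x n ^ 2`, and the roots of the constants tend to `1`. -/
theorem mul_sq_le_of_tendsto {x a : ℕ → ℝ} {l q C b : ℝ} (hl : 0 < l) (hq : 0 < q) (hC : 0 < C)
    (hb : 0 ≤ b) (ha : ∀ n, 0 ≤ a n) (hx : Tendsto x atTop (𝓝 l))
    (hxa : ∀ n : ℕ, x n ≤ a n ^ (1 / (2 * (n : ℝ)))) (h : ∀ n : ℕ, q ^ (n + 1) * a n ≤ C * b ^ n) :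
    q * l ^ 2 ≤ b := by
  have hinv : Tendsto (fun n : ℕ => 1 / (n : ℝ)) atTop (𝓝 0) := tendsto_one_div_atTop_nhds_zero_nat
  have hroot : ∀ c : ℝ, 0 < c → Tendsto (fun n : ℕ => c ^ (1 / (n : ℝ))) atTop (𝓝 1) := fun c hc => by
    have := ((Real.continuousAt_const_rpow hc.ne' (b := 0)).tendsto).comp hinv
    simpa [Function.comp_def] using this
  have h1 : Tendsto (fun n : ℕ => q * q ^ (1 / (n : ℝ)) * x n ^ 2) atTop (𝓝 (q * 1 * l ^ 2)) :=
    ((hroot q hq).const_mul q).mul (hx.pow 2)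
  have h2 : Tendsto (fun n : ℕ => C ^ (1 / (n : ℝ)) * b) atTop (𝓝 (1 * b)) :=
    (hroot C hC).mul_const b
  rw [mul_one] at h1
  rw [one_mul] at h2
  refine le_of_tendsto_of_tendsto h1 h2 ?_
  -- Positivity of `x n` allows squaring `hxa`; at `n = 0` the exponents would degenerate to `0`.
  filter_upwards [hx.eventually (lt_mem_nhds hl), eventually_ge_atTop 1] with n hn hn1
  have hn0 : (n : ℝ) ≠ 0 := by positivity
  have e1 : x n ^ 2 ≤ a n ^ (1 / (n : ℝ)) := by
    refine (pow_le_pow_left₀ hn.le (hxa n) 2).trans_eq ?_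
    rw [← Real.rpow_natCast, ← Real.rpow_mul (ha n)]
    congr 1
    field_simp
    norm_num
  have e2 : q * q ^ (1 / (n : ℝ)) = (q ^ (n + 1)) ^ (1 / (n : ℝ)) := by
    rw [← Real.rpow_natCast q, ← Real.rpow_mul hq.le]
    nth_rewrite 1 [← Real.rpow_one q]
    rw [← Real.rpow_add hq]
    congr 1
    push_cast
    field_simp
  have e3 : C ^ (1 / (n : ℝ)) * b = (C * b ^ n) ^ (1 / (n : ℝ)) := by
    rw [Real.mul_rpow hC.le (pow_nonneg hb n), one_div, Real.pow_rpow_inv_natCast hb (by omega)]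
  calc q * q ^ (1 / (n : ℝ)) * x n ^ 2 ≤ q * q ^ (1 / (n : ℝ)) * a n ^ (1 / (n : ℝ)) :=
        mul_le_mul_of_nonneg_left e1 (by positivity)
    _ = (q ^ (n + 1) * a n) ^ (1 / (n : ℝ)) := by
        rw [e2, Real.mul_rpow (by positivity) (ha n)]
    _ ≤ (C * b ^ n) ^ (1 / (n : ℝ)) :=
        Real.rpow_le_rpow (mul_nonneg (by positivity) (ha n)) (h n) (by positivity)
    _ = _ := e3.symm

theorem posSemidef_transpose_mul_self {N : ℕ} (A : Matrix (Fin N) (Fin N) ℝ) :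
    (Aᵀ * A).PosSemidef := by
  rw [← conjTranspose_eq_transpose_of_trivial]
  exact posSemidef_conjTranspose_mul_self _

section lyapunov

variable {N : ℕ} {f : Vec N → Vec N} {x : Vec N} {Λ : Fin N → ℝ}

/-- The determinant is continuous and commutes with the power `1/(2n)`. The limit matrix has `N`
real roots, so its determinant is their product. -/
theorem HasLyapunovExponentsAt.prod_le (h : HasLyapunovExponentsAt f x Λ) {q C b : ℝ} (hq : 0 < q)
    (hC : 0 < C) (hb : 0 ≤ b)
    (hbd : ∀ n : ℕ, q ^ (n + 1) * ((jacProd f x n)ᵀ * jacProd f x n).det ≤ C * b ^ n) :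
    q * ∏ i, Real.exp (Λ i) ^ 2 ≤ b := by
  obtain ⟨L, hL, hroots⟩ := h
  have hdet : L.det = ∏ i, Real.exp (Λ i) := by
    rw [det_eq_prod_roots_charpoly_of_splits, hroots]
    · rfl
    · rw [Polynomial.splits_iff_card_roots, hroots]
      simp [charpoly_natDegree_eq_dim]
  rw [Finset.prod_pow, ← hdet]
  refine mul_sq_le_of_tendsto ?_ hq hC hb (fun n => (posSemidef_transpose_mul_self _).det_nonneg)
    ((Continuous.matrix_det continuous_id).tendsto L |>.comp hL) (fun n => ?_) hbd
  · rw [hdet]; exact Finset.prod_pos fun i _ => Real.exp_pos _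
  · exact (det_cfc_rpow (posSemidef_transpose_mul_self _) _).le

/-- Fix an eigenvector of the limit `L`. The Rayleigh quotients of the approximating matrices at
this vector converge to the eigenvalue, and each is at most the trace to the power `1/(2n)`. -/
theorem HasLyapunovExponentsAt.exp_sq_le (h : HasLyapunovExponentsAt f x Λ) {q C b : ℝ}
    (hq : 0 < q) (hC : 0 < C) (hb : 0 ≤ b)
    (hbd : ∀ n : ℕ, q ^ (n + 1) * ((jacProd f x n)ᵀ * jacProd f x n).trace ≤ C * b ^ n)
    (i : Fin N) : q * Real.exp (Λ i) ^ 2 ≤ b := by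
  obtain ⟨L, hL, hroots⟩ := h
  obtain ⟨v, hv0, hv⟩ := exists_eigenvector (A := L) (z := Real.exp (Λ i)) (by rw [hroots]; simp)
  have hvv : 0 < v ⬝ᵥ v := by simpa using dotProduct_star_self_pos_iff.mpr hv0
  have hcont : Continuous fun M : Matrix (Fin N) (Fin N) ℝ => v ⬝ᵥ (M *ᵥ v) / (v ⬝ᵥ v) :=
    (Continuous.dotProduct continuous_const (continuous_id.matrix_mulVec continuous_const)).div_const
      _
  have hlim := (hcont.tendsto L).comp hL
  rw [hv, dotProduct_smul, smul_eq_mul, mul_div_cancel_right₀ _ hvv.ne'] at hlim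
  refine mul_sq_le_of_tendsto (Real.exp_pos _) hq hC hb
    (fun n => (posSemidef_transpose_mul_self _).trace_nonneg) hlim (fun n => ?_) hbd
  rw [Function.comp_apply, div_le_iff₀ hvv]
  exact dotProduct_cfc_rpow_le (posSemidef_transpose_mul_self _) (by positivity) le_rfl v

end lyapunov

/-! ### Eigenvalues at the fixed point -/

theorem det_sq_eq_prod_eigenvaluesC {N : ℕ} {A : Matrix (Fin N) (Fin N) ℝ} {lam : Fin N → ℂ}
    (h : eigenvaluesC A = Finset.univ.val.map lam) : A.det ^ 2 = ∏ i, ‖lam i‖ ^ 2 := by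
  have h1 : (A.map (algebraMap ℝ ℂ)).det = ∏ i, lam i := by
    rw [det_eq_prod_roots_charpoly]
    exact congrArg Multiset.prod h
  have h2 : (A.map (algebraMap ℝ ℂ)).det = (A.det : ℂ) :=
    ((algebraMap ℝ ℂ).map_det A).symm
  rw [Finset.prod_pow, ← norm_prod, ← h1, h2, Complex.norm_real, Real.norm_eq_abs, sq_abs]

/-- The trace is the squared Frobenius norm, which bounds the operator norm also on complex vectors:
Cauchy–Schwarz in each row. -/
theorem norm_sq_le_trace_of_eigenvector {N : ℕ} {M : Matrix (Fin N) (Fin N) ℝ} {z : ℂ}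
    {v : Fin N → ℂ} (hv0 : v ≠ 0) (hv : M.map (algebraMap ℝ ℂ) *ᵥ v = z • v) :
    ‖z‖ ^ 2 ≤ (Mᵀ * M).trace := by
  have hpos : 0 < ∑ i, ‖v i‖ ^ 2 := by
    obtain ⟨i, hi⟩ := Function.ne_iff.mp hv0
    exact Finset.sum_pos' (fun _ _ => sq_nonneg _)
      ⟨i, Finset.mem_univ _, pow_pos (norm_pos_iff.mpr hi) 2⟩
  refine le_of_mul_le_mul_right ?_ hpos
  have htr : (Mᵀ * M).trace = ∑ i, ∑ j, M i j ^ 2 := by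
    rw [trace_mul_comm]
    simp [trace, mul_apply, pow_two]
  rw [htr, Finset.mul_sum, Finset.sum_mul]
  refine Finset.sum_le_sum fun i _ => ?_
  have hi : z * v i = ∑ j, (M i j : ℂ) * v j := (congrFun hv i).symm
  rw [← mul_pow, ← norm_mul, hi]
  calc ‖∑ j, (M i j : ℂ) * v j‖ ^ 2 ≤ (∑ j, |M i j| * ‖v j‖) ^ 2 := by
        refine pow_le_pow_left₀ (norm_nonneg _) ((norm_sum_le _ _).trans_eq ?_) 2
        simp
    _ ≤ (∑ j, |M i j| ^ 2) * ∑ j, ‖v j‖ ^ 2 := Finset.sum_mul_sq_le_sq_mul_sq _ _ _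
    _ = _ := by simp

theorem norm_pow_sq_le_trace {N : ℕ} {A : Matrix (Fin N) (Fin N) ℝ} {z : ℂ}
    (hz : z ∈ eigenvaluesC A) (n : ℕ) : (‖z‖ ^ 2) ^ n ≤ ((A ^ n)ᵀ * A ^ n).trace := by
  obtain ⟨v, hv0, hv⟩ := exists_eigenvector hz
  rw [← pow_mul, mul_comm, pow_mul, ← norm_pow]
  refine norm_sq_le_trace_of_eigenvector hv0 ?_
  have hmap : (A ^ n).map (algebraMap ℝ ℂ) = A.map (algebraMap ℝ ℂ) ^ n :=
    map_pow (algebraMap ℝ ℂ).mapMatrix A n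
  rw [hmap]
  induction n with
  | zero => simp
  | succ n ih =>
    rw [pow_succ, ← mulVec_mulVec, hv, mulVec_smul, ih (map_pow (algebraMap ℝ ℂ).mapMatrix A n),
      smul_smul, pow_succ']

end FadingChannel

end

/-! ### The necessary conditions for stability -/

theorem mainTheorem1 {N d : ℕ} (hd : 1 ≤ d)
    {Ω : Type*} [MeasurableSpace Ω] (P : Measure Ω) [IsProbabilityMeasure P]
    (f : FadingChannel.Vec N → FadingChannel.Vec N) (B : Matrix (Fin N) (Fin d) ℝ)
    (hf : FadingChannel.PlantAssumption f B)
    (hctrl : FadingChannel.UniformlyControllable f B)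
    (m : Measure (FadingChannel.Vec N)) (hm : FadingChannel.IsUniquePhysicalMeasure f m)
    (Λ : Fin N → ℝ) (hΛ : FadingChannel.HasLyapunovExponents f m Λ) (hΛ_pos : ∀ i, 0 < Λ i)
    (lam₀ : Fin N → ℂ)
    (hlam₀ : FadingChannel.eigenvaluesC (FadingChannel.jac f 0) = Finset.univ.val.map lam₀)
    (μ σ : ℝ) (ξ : ℕ → Ω → ℝ) (hξ : FadingChannel.ChannelNoise P μ σ ξ)
    (γ : ℕ → Ω → FadingChannel.Vec N) (hγ : FadingChannel.AdditiveNoise P γ)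
    (k : FadingChannel.Vec N → FadingChannel.Vec d)
    (hk : FadingChannel.ControllerAssumption f B μ k)
    (hstable : FadingChannel.MSExpIncrementallyStable P f B k ξ γ)
    (ρ : ℝ) (hρ : ρ = μ ^ 2 / (μ ^ 2 + σ ^ 2)) :
    (d < N →
      (1 - ρ) ^ d * max (∏ i, Real.exp (Λ i) ^ 2) (∏ i, ‖lam₀ i‖ ^ 2) < 1) ∧
    (d = N →
      (1 - ρ) * max ((⨆ i, Real.exp (Λ i)) ^ 2) ((⨆ i, ‖lam₀ i‖) ^ 2) < 1) := by
  have hσ : 0 < σ ^ 2 := sq_pos_of_ne_zero hξ.sigma_ne_zero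
  have hr0 : 0 < 1 - ρ := by
    rw [hρ, sub_pos, div_lt_one (by positivity)]; linarith
  have := hm.isProbabilityMeasure
  -- One point with the right exponents suffices. It may lie in a Lebesgue null set, since `m` can
  -- be singular; hence the need for the decay bound at every initial state.
  obtain ⟨x, hx⟩ := hΛ.exists
  obtain ⟨C, β, hC, hβ0, hβ1, hb⟩ := FadingChannel.exists_jacProd_bounds hf.contDiff hk.contDiff
    hξ x (hstable _).2
  obtain ⟨C₀, β₀, hC₀, hβ₀0, hβ₀1, hb₀⟩ := FadingChannel.exists_jacProd_bounds hf.contDiff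
    hk.contDiff hξ 0 (hstable _).2
  simp only [← hρ] at hb hb₀
  simp only [FadingChannel.jacProd_of_fixed hf.map_zero] at hb₀
  constructor
  · intro hdN
    have hN : N ≠ 0 := by omega
    rw [mul_max_of_nonneg _ _ (by positivity), max_lt_iff]
    constructor
    · exact (hx.prod_le (pow_pos hr0 d) (pow_pos hC N) (by positivity)
        fun n => (hb n).2).trans_lt (pow_lt_one₀ hβ0.le hβ1 hN)
    · rw [← FadingChannel.det_sq_eq_prod_eigenvaluesC hlam₀]
      -- At the fixed point the determinant of `Φ'Φ` is an exact power, so geometric decay alone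
      -- forces the base below `1`, with no roots to take.
      refine FadingChannel.lt_one_of_pow_le (pow_nonneg hβ₀0.le N) (pow_lt_one₀ hβ₀0.le hβ₀1 hN)
        fun n => le_of_eq_of_le ?_ (hb₀ n).2
      rw [Matrix.det_mul, Matrix.det_transpose, Matrix.det_pow]
      ring
  · rintro rfl
    have : Nonempty (Fin d) := ⟨⟨0, hd⟩⟩
    rw [mul_max_of_nonneg _ _ hr0.le, max_lt_iff]
    constructor
    · obtain ⟨i, hi⟩ := exists_eq_ciSup_of_finite (f := fun i => Real.exp (Λ i))
      rw [← hi]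
      exact (hx.exp_sq_le hr0 hC hβ0.le (fun n => (hb n).1) i).trans_lt hβ1
    · obtain ⟨i, hi⟩ := exists_eq_ciSup_of_finite (f := fun i => ‖lam₀ i‖)
      rw [← hi]
      refine FadingChannel.lt_one_of_pow_le hβ₀0.le hβ₀1 fun n => le_trans ?_ (hb₀ n).1
      rw [mul_pow]
      exact mul_le_mul_of_nonneg_left
        (FadingChannel.norm_pow_sq_le_trace (by rw [hlam₀]; simp) (n + 1)) (by positivity)
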